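/- Let $F$ be a function from $\mathrm{GF}(2^n)$ to itself, and for $a,b\in\mathrm{GF}(2^n)$ put $\delta(a,b)=\#\{x\in\mathrm{GF}(2^n): F(x+a)+F(x)=b\}$. Suppose that $F$ is differentially two-valued with $\{0,2^s\}$, that is, $$\{\delta(a,b): a\in \mathrm{GF}(2^n)^*,\ b\in\mathrm{GF}(2^n)\}=\{0,2^s\},$$ and that its Walsh coefficients $\mathcal W_F(\lambda,\mu)=\sum_{x\in\mathrm{GF}(2^n)}(-1)^{\mathrm{Tr}(\lambda F(x)+\mu x)}$, where $\mathrm{Tr}$ is the absolute trace from $\mathrm{GF}(2^n)$ to $\mathrm{GF}(2)$, satisfy $$\{\mathcal W_F(\lambda,\mu): \lambda\in\mathrm{GF}(2^n)^*,\ \mu\in\mathrm{GF}(2^n)\}=\{0,\ 2^{\frac{n+s}{2}},\ -2^{\frac{n+s}{2}}\}.$$ Let $\mathcal C(F)$ be the binary linear code $$\mathcal C(F)=\left\{\left(\mathrm{Tr}(aF(x)+bx)+c\right)_{x\in\mathrm{GF}(2^n)}: a,b\in\mathrm{GF}(2^n),\ c\in\mathrm{GF}(2)\right\}$$ of length $2^n$,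 and let $\mathcal C(F)^\perp$ be its dual code. Then $\mathcal C(F)$ and $\mathcal C(F)^\perp$ both support $2$-designs: for each $\mathcal C\in\{\mathcal C(F),\mathcal C(F)^\perp\}$ and each integer $w$ with $0\le w\le 2^n$ there is an integer $\lambda\ge 0$ such that every $2$-element set of coordinate positions is contained in exactly $\lambda$ of the supports of the codewords of Hamming weight $w$ in $\mathcal C$ (with $\lambda=0$ if there are no such codewords). -/

import Mathlib

open Finset

noncomputable section

namespace VectorialDesign

/-- A `t`-`(ν, k, l)` design on the finite point set `P`, where `ν = #P`: a multiset of `k`-subsets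
of `P` (the blocks; repetitions are allowed) such that every `t`-subset of `P` is contained in
exactly `l` blocks, counted with multiplicity. -/
structure IsDesign {P : Type*} [Fintype P] (t k l : ℕ) (blocks : Multiset (Finset P)) : Prop where
  one_le : 1 ≤ t
  le_points : t ≤ Fintype.card P
  card_block : ∀ B ∈ blocks, B.card = k
  card_blocks_containing : ∀ T : Finset P, T.card = t →
    Multiset.card (open Classical in blocks.filter (fun B => T ⊆ B)) = l

section Codes

variable {P : Type*} [Fintype P]

/-- The support of a binary word whose coordinates are indexed by `P`; its cardinality is the
Hamming weight of the word. -/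
def support (c : P → ZMod 2) : Finset P := {i | c i ≠ 0}

/-- The multiset of the supports of the codewords of Hamming weight `w` in a binary linear code `C`
(over `GF(q)` the multiplicities are divided by `q - 1`, which is `1` here). -/
def blocksOfWeight (C : Submodule (ZMod 2) (P → ZMod 2)) (w : ℕ) : Multiset (Finset P) :=
  open Classical in
    ((univ : Finset (P → ZMod 2)).filter (fun c => c ∈ C ∧ (support c).card = w)).val.map support

/-- A binary linear code of length `ν` supports `t`-designs if, for every `0 ≤ w ≤ ν`, the supports
of its codewords of weight `w` form a `t`-`(ν, w, l)` design for some `l`. -/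
def SupportsDesigns (C : Submodule (ZMod 2) (P → ZMod 2)) (t : ℕ) : Prop :=
  ∀ w ≤ Fintype.card P, ∃ l : ℕ, IsDesign t w l (blocksOfWeight C w)

/-- The dual code with respect to the standard inner product. -/
def dualCode (C : Submodule (ZMod 2) (P → ZMod 2)) : Submodule (ZMod 2) (P → ZMod 2) where
  carrier := {c | ∀ v ∈ C, c ⬝ᵥ v = 0}
  zero_mem' := fun v _ => zero_dotProduct v
  add_mem' := fun ha hb v hv => by rw [add_dotProduct, ha v hv, hb v hv, add_zero]
  smul_mem' := fun r c hc v hv => by rw [smul_dotProduct, hc v hv, smul_zero]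

end Codes

section Functions

variable {K : Type*} [Field K] [Fintype K]

/-- `δ(a, b) = #{x : F(x + a) + F(x) = b}`. -/
def diffCount (F : K → K) (a b : K) : ℕ :=
  open Classical in ((univ : Finset K).filter (fun x => F (x + a) + F x = b)).card

/-- `F` is differentially two-valued with `{0, 2 ^ s}`. -/
def IsDiffTwoValued (F : K → K) (s : ℕ) : Prop :=
  {d : ℕ | ∃ a b : K, a ≠ 0 ∧ diffCount F a b = d} = {0, 2 ^ s}

variable [Algebra (ZMod 2) K]

/-- The Walsh transform `∑ x, (-1) ^ Tr(u F(x) + v x)`, with the absolute trace. -/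
def walsh (F : K → K) (u v : K) : ℤ :=
  ∑ x : K, (-1) ^ (Algebra.trace (ZMod 2) K (u * F x + v * x)).val

/-- The binary linear code of all words `(Tr(a F(x) + b x) + c)_x` with `a, b` in the field and
`c` in `GF(2)`. -/
def code (F : K → K) : Submodule (ZMod 2) (K → ZMod 2) where
  carrier := {w | ∃ (a b : K) (c : ZMod 2),
    w = fun x => Algebra.trace (ZMod 2) K (a * F x + b * x) + c}
  zero_mem' := ⟨0, 0, 0, by ext x; simp⟩
  add_mem' := by
    rintro _ _ ⟨a, b, c, rfl⟩ ⟨a', b', c', rfl⟩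
    refine ⟨a + a', b + b', c + c', ?_⟩
    ext x
    simp only [Pi.add_apply, add_mul, map_add]
    ring
  smul_mem' := by
    rintro r _ ⟨a, b, c, rfl⟩
    refine ⟨r • a, r • b, r * c, ?_⟩
    ext x
    simp only [Pi.smul_apply, smul_eq_mul, smul_mul_assoc, map_add, map_smul]
    ring

end Functions

end VectorialDesign

end

set_option linter.unusedSectionVars false

namespace VectorialDesign

/-! For a word with parameters `p = (u, v, c)` let S be the sum of its signs, so that the weight is
(2^n - S)/2. It suffices that, for x ≠ y, the joint distribution of S and the bits at x and y does
not depend on the pair. On u ≠ 0, S takes only the values 0, M, -M, hence the distribution is fixed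
by the moments of S^k ε_x^i ε_y^j with k ≤ 2 and i, j ≤ 1, where ε denotes signs
(`exists_moment_coeff`). Those of odd degree vanish under complementation. The others do not involve
x, y or follow from orthogonality of characters; the decisive one, S^2 ε_x ε_y, is 2^(2n+1) δ(x + y,
F x + F y), and this δ equals 2^s because x is itself a solution. The slice u = 0 has other values
of S and is treated separately (`constSum_moment_affine`). The dual code follows by a MacWilliams
transform refined at two coordinates (`sum_sgn_mul_X_pow`). -/

/-- The sign `(-1) ^ z` of a bit. -/
noncomputable def sgn (z : ZMod 2) : ℝ := (-1) ^ z.val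

theorem sgn_zero : sgn 0 = 1 := by simp [sgn]

theorem sgn_one : sgn 1 = -1 := by simp [sgn, ZMod.val_one]

theorem zmod_two_cases (z : ZMod 2) : z = 0 ∨ z = 1 := by
  revert z; decide

theorem sgn_add (a b : ZMod 2) : sgn (a + b) = sgn a * sgn b := by
  have h : (1 + 1 : ZMod 2) = 0 := by decide
  rcases zmod_two_cases a with rfl | rfl <;> rcases zmod_two_cases b with rfl | rfl <;>
    simp [sgn_zero, sgn_one, h]

theorem sgn_sum {ι : Type*} (s : Finset ι) (f : ι → ZMod 2) :
    sgn (∑ i ∈ s, f i) = ∏ i ∈ s, sgn (f i) := by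
  classical
  induction s using Finset.induction_on with
  | empty => simp [sgn_zero]
  | insert a s ha ih => rw [sum_insert ha, prod_insert ha, sgn_add, ih]

/-! ### Pair-homogeneous codes and their duals support 2-designs. -/

section Codes

open Classical

variable {P : Type*} [Fintype P]

/-- The weight distribution of `C`, refined by the values at two distinct coordinates, does not
depend on the choice of the two coordinates. -/
def PairHomogeneous (C : Submodule (ZMod 2) (P → ZMod 2)) : Prop :=
  ∀ G : ℕ → ZMod 2 → ZMod 2 → ℝ, ∃ L : ℝ, ∀ x y : P, x ≠ y →
    ∑ c : P → ZMod 2 with c ∈ C, G (support c).card (c x) (c y) = L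

theorem ne_zero_iff_eq_one (z : ZMod 2) : z ≠ 0 ↔ z = 1 := by
  revert z; decide

theorem supportsDesigns_two_of_card_eq (C : Submodule (ZMod 2) (P → ZMod 2))
    (hP : 2 ≤ Fintype.card P)
    (h : ∀ w : ℕ, ∃ L : ℝ, ∀ x y : P, x ≠ y →
      ((univ.filter fun c : P → ZMod 2 =>
        c ∈ C ∧ (support c).card = w ∧ c x = 1 ∧ c y = 1).card : ℝ) = L) :
    SupportsDesigns C 2 := by
  intro w _
  obtain ⟨L, hL⟩ := h w
  -- A reference pair turns the real constant `L` into the natural number required of a design.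
  obtain ⟨x₀, y₀, hxy⟩ := Fintype.one_lt_card_iff.mp (show 1 < Fintype.card P by omega)
  refine ⟨(univ.filter fun c : P → ZMod 2 =>
        c ∈ C ∧ (support c).card = w ∧ c x₀ = 1 ∧ c y₀ = 1).card, by norm_num, hP, ?_, ?_⟩
  · intro B hB
    simp only [blocksOfWeight, Multiset.mem_map, Finset.mem_val, mem_filter] at hB
    obtain ⟨c, hc, rfl⟩ := hB
    exact hc.2.2
  · intro T hT
    obtain ⟨x, y, hne, rfl⟩ := card_eq_two.mp hT
    have e : ((univ.filter fun c : P → ZMod 2 =>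
        c ∈ C ∧ (support c).card = w ∧ c x = 1 ∧ c y = 1).card) =
        (univ.filter fun c : P → ZMod 2 =>
        c ∈ C ∧ (support c).card = w ∧ c x₀ = 1 ∧ c y₀ = 1).card := by
      have := (hL x y hne).trans (hL x₀ y₀ hxy).symm
      exact_mod_cast this
    rw [← e, blocksOfWeight, Multiset.filter_map, Multiset.card_map, ← Finset.filter_val,
      Finset.card_val, Finset.filter_filter]
    congr 1
    ext c
    simp only [mem_filter, mem_univ, true_and, Function.comp, insert_subset_iff,
      singleton_subset_iff, support, ne_zero_iff_eq_one, and_assoc]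

theorem PairHomogeneous.supportsDesigns {C : Submodule (ZMod 2) (P → ZMod 2)}
    (h : PairHomogeneous C) (hP : 2 ≤ Fintype.card P) : SupportsDesigns C 2 := by
  refine supportsDesigns_two_of_card_eq C hP fun w => ?_
  obtain ⟨L, hL⟩ := h fun k a b => if k = w ∧ a = 1 ∧ b = 1 then 1 else 0
  refine ⟨L, fun x y hxy => ?_⟩
  rw [← hL x y hxy, Finset.sum_boole, Finset.filter_filter]

/-- Orthogonality of characters: if `d` is not in the dual, translation by some `v ∈ C` with `d ⬝ᵥ v
= 1` flips every sign. -/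
theorem sum_sgn_dotProduct (C : Submodule (ZMod 2) (P → ZMod 2)) (d : P → ZMod 2) :
    ∑ c : P → ZMod 2 with c ∈ C, sgn (d ⬝ᵥ c) =
      if d ∈ dualCode C then ((univ.filter fun c : P → ZMod 2 => c ∈ C).card : ℝ) else 0 := by
  split_ifs with hd
  · rw [Finset.card_eq_sum_ones, Nat.cast_sum]
    refine sum_congr rfl fun c hc => ?_
    rw [show d ⬝ᵥ c = 0 from hd c (mem_filter.mp hc).2, sgn_zero, Nat.cast_one]
  · have : ∃ v ∈ C, d ⬝ᵥ v ≠ 0 := by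
      by_contra! hcon
      exact hd hcon
    obtain ⟨v, hv, hdv⟩ := this
    rw [ne_zero_iff_eq_one] at hdv
    have key : ∑ c : P → ZMod 2 with c ∈ C, sgn (d ⬝ᵥ c) =
        ∑ c : P → ZMod 2 with c ∈ C, -sgn (d ⬝ᵥ c) := by
      refine sum_equiv (Equiv.addRight v) (fun c => ?_) (fun c _ => ?_)
      · simp [C.add_mem_iff_left hv]
      · simp [dotProduct_add, sgn_add, hdv, sgn_one]
    rw [sum_neg_distrib] at key
    linarith

open Polynomial in
/-- The signed weight enumerator of the words that are `1` at two marked coordinates. -/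
theorem sum_sgn_mul_X_pow (c : P → ZMod 2) {x y : P} (hxy : x ≠ y) :
    ∑ d : P → ZMod 2, (if d x = 1 ∧ d y = 1 then
        Polynomial.C (sgn (d ⬝ᵥ c)) * X ^ (support d).card else 0 : ℝ[X]) =
      Polynomial.C (sgn (c x) * sgn (c y)) * X ^ 2 *
        ((1 - X) ^ ((support c).card - (c x).val - (c y).val) *
          (1 + X) ^ (Fintype.card P - 2 - ((support c).card - (c x).val - (c y).val))) := by
  -- The summand factors over coordinates; the first factor of `h` kills words that are 0 at a
  -- marked point. Summing over bits, a marked point leaves ±X and any other point 1 ± X.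
  let h : P → ZMod 2 → ℝ[X] := fun i b =>
    (if (i = x ∨ i = y) ∧ b = 0 then 0 else 1) * (Polynomial.C (sgn (b * c i)) * X ^ b.val)
  have h1 : ∀ d : P → ZMod 2, (if d x = 1 ∧ d y = 1 then
        Polynomial.C (sgn (d ⬝ᵥ c)) * X ^ (support d).card else 0 : ℝ[X]) = ∏ i, h i (d i) := by
    intro d
    have hs : (support d).card = ∑ i, (d i).val := by
      rw [support, card_filter]
      refine sum_congr rfl fun i _ => ?_
      rcases zmod_two_cases (d i) with e | e <;> simp [e, ZMod.val_one]
    simp only [h]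
    rw [prod_mul_distrib, prod_mul_distrib, prod_pow_eq_pow_sum, ← hs, ← map_prod, ← sgn_sum]
    change _ = _ * (Polynomial.C (sgn (d ⬝ᵥ c)) * _)
    split_ifs with hd
    · rw [prod_eq_one, one_mul]
      intro i _
      rw [if_neg]
      rintro ⟨rfl | rfl, h0⟩ <;> simp_all
    · have : ∃ i, (i = x ∨ i = y) ∧ d i = 0 := by
        by_contra! hcon
        exact hd ⟨(ne_zero_iff_eq_one _).mp (hcon x (Or.inl rfl)),
          (ne_zero_iff_eq_one _).mp (hcon y (Or.inr rfl))⟩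
      obtain ⟨i, hi⟩ := this
      rw [prod_eq_zero (mem_univ i) (by rw [if_pos hi]), zero_mul]
  rw [sum_congr rfl fun d _ => h1 d]
  have h2 : ∑ d : P → ZMod 2, ∏ i, h i (d i) = ∏ i, ∑ b, h i b := by
    rw [prod_univ_sum, Fintype.piFinset_univ]
  have h3 : ∀ i, ∑ b, h i b = if i ∈ ({x, y} : Finset P) then Polynomial.C (sgn (c i)) * X
      else (if c i = 1 then 1 - X else 1 + X) := by
    intro i
    have e : ∑ b, h i b = h i 0 + h i 1 := Fin.sum_univ_two _
    rw [e]
    by_cases hi : i = x ∨ i = y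
    · simp [h, hi, ZMod.val_one]
    · rcases zmod_two_cases (c i) with e | e <;>
        simp [h, hi, e, ZMod.val_one, sgn_zero, sgn_one, sub_eq_add_neg]
  rw [h2, prod_congr rfl fun i _ => h3 i, prod_ite]
  have h4 : (univ.filter fun i => i ∈ ({x, y} : Finset P)) = {x, y} := by ext; simp
  rw [h4, prod_pair hxy, prod_ite, prod_const, prod_const, filter_filter, filter_filter]
  have h5 : (univ.filter fun i => i ∉ ({x, y} : Finset P) ∧ c i = 1).card =
      (support c).card - (c x).val - (c y).val := by
    have e : (support c).card = ∑ i, (c i).val := by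
      rw [support, card_filter]
      refine sum_congr rfl fun i _ => ?_
      rcases zmod_two_cases (c i) with e | e <;> simp [e, ZMod.val_one]
    have e2 : (univ.filter fun i => i ∉ ({x, y} : Finset P) ∧ c i = 1).card =
        ∑ i ∈ ({x, y} : Finset P)ᶜ, (c i).val := by
      rw [← filter_filter, card_filter]
      refine sum_congr (by ext; simp) fun i _ => ?_
      rcases zmod_two_cases (c i) with e | e <;> simp [e, ZMod.val_one]
    -- The two marked bits are part of the weight, so the truncated subtractions are exact.
    rw [e2, e, ← sum_compl_add_sum {x, y}, sum_pair hxy]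
    omega
  have h6 : (univ.filter fun i => i ∉ ({x, y} : Finset P) ∧ ¬ c i = 1).card =
      Fintype.card P - 2 - ((support c).card - (c x).val - (c y).val) := by
    have hc : ({x, y} : Finset P)ᶜ.card = Fintype.card P - 2 := by
      rw [card_compl, card_pair hxy]
    rw [← h5, ← hc]
    have := card_filter_add_card_filter_not (s := ({x, y} : Finset P)ᶜ) (fun i => c i = 1)
    rw [← this, ← filter_filter, ← filter_filter]
    have e : (univ.filter fun i => i ∉ ({x, y} : Finset P)) = ({x, y} : Finset P)ᶜ := by
      ext; simp
    rw [e]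
    omega
  rw [h5, h6, map_mul]
  ring

theorem PairHomogeneous.supportsDesigns_dualCode {C : Submodule (ZMod 2) (P → ZMod 2)}
    (h : PairHomogeneous C) (hP : 2 ≤ Fintype.card P) : SupportsDesigns (dualCode C) 2 := by
  refine supportsDesigns_two_of_card_eq _ hP fun w => ?_
  -- The test function is the coefficient of X^w in the refined enumerator, which depends on `c`
  -- only through its weight and its two marked bits.
  obtain ⟨L, hL⟩ := h fun k a b => (Polynomial.C (sgn a * sgn b) * Polynomial.X ^ 2 *
        ((1 - Polynomial.X) ^ (k - a.val - b.val) *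
          (1 + Polynomial.X) ^ (Fintype.card P - 2 - (k - a.val - b.val)))).coeff w
  have hC : ((univ.filter fun c : P → ZMod 2 => c ∈ C).card : ℝ) ≠ 0 := by
    rw [Nat.cast_ne_zero]
    exact (card_pos.mpr ⟨0, by simp⟩).ne'
  refine ⟨L / (univ.filter fun c : P → ZMod 2 => c ∈ C).card, fun x y hxy => ?_⟩
  rw [eq_div_iff hC, ← hL x y hxy]
  simp only [← sum_sgn_mul_X_pow _ hxy, Polynomial.finsetSum_coeff]
  rw [sum_comm, card_filter, Nat.cast_sum, sum_mul]
  refine sum_congr rfl fun d _ => ?_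
  by_cases hd : d x = 1 ∧ d y = 1
  · simp only [if_pos hd, Polynomial.coeff_C_mul, Polynomial.coeff_X_pow]
    rw [← sum_mul, sum_sgn_dotProduct]
    simp only [eq_comm (a := w)]
    by_cases h1 : d ∈ dualCode C <;> by_cases h2 : (support d).card = w <;>
      simp [h1, h2, hd]
  · simp only [if_neg hd, Polynomial.coeff_zero, sum_const_zero]
    rw [if_neg (fun hh => hd hh.2.2)]
    simp

end Codes

/-! ### Character sums over the parameters of the code. -/

section Functions

open Classical

variable {K : Type*} [Field K] [Fintype K] [Algebra (ZMod 2) K]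

/-- The codeword of `code F` with the parameters `p = (u, v, c)`. -/
noncomputable def word (F : K → K) (p : K × K × ZMod 2) (x : K) : ZMod 2 :=
  Algebra.trace (ZMod 2) K (p.1 * F x + p.2.1 * x) + p.2.2

/-- The sum of the signs of the entries of a codeword. -/
noncomputable def signSum (F : K → K) (p : K × K × ZMod 2) : ℝ := ∑ x, sgn (word F p x)

/-- The trace form is nondegenerate: for `z ≠ 0` and `t` of trace 1, the shift of `v` by `t / z`
flips every sign. -/
theorem sum_sgn_trace (z : K) :
    ∑ v : K, sgn (Algebra.trace (ZMod 2) K (v * z)) = if z = 0 then (Fintype.card K : ℝ) else 0 := by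
  split_ifs with hz
  · simp [hz, sgn_zero]
  · obtain ⟨t, ht⟩ : ∃ t : K, Algebra.trace (ZMod 2) K t ≠ 0 := by
      by_contra! hcon
      exact Algebra.trace_ne_zero (ZMod 2) K (LinearMap.ext hcon)
    rw [ne_zero_iff_eq_one] at ht
    have key : ∑ v : K, sgn (Algebra.trace (ZMod 2) K (v * z)) =
        ∑ v : K, -sgn (Algebra.trace (ZMod 2) K (v * z)) := by
      symm
      refine Fintype.sum_equiv (Equiv.addRight (t / z)) _ _ fun v => ?_
      simp [add_mul, div_mul_cancel₀ _ hz, sgn_add, ht, sgn_one]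
    rw [sum_neg_distrib] at key
    linarith

theorem word_add (F : K → K) (p : K × K × ZMod 2) (x y : K) :
    word F p x + word F p y =
      Algebra.trace (ZMod 2) K (p.1 * (F x + F y)) +
        Algebra.trace (ZMod 2) K (p.2.1 * (x + y)) := by
  have h : ∀ a : ZMod 2, a + a = 0 := by decide
  simp only [word, mul_add, map_add]
  linear_combination h p.2.2

theorem sum_sgn_trace_mul_sgn_trace (a b : K) :
    ∑ p : K × K × ZMod 2, sgn (Algebra.trace (ZMod 2) K (p.1 * a)) *
        sgn (Algebra.trace (ZMod 2) K (p.2.1 * b)) =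
      if a = 0 ∧ b = 0 then 2 * (Fintype.card K : ℝ) ^ 2 else 0 := by
  simp only [Fintype.sum_prod_type, sum_const, card_univ, ZMod.card, nsmul_eq_mul]
  simp only [← mul_sum, ← sum_mul, sum_sgn_trace]
  split_ifs <;> simp_all
  ring

theorem sum_sgn_word_two (F : K → K) (x y : K) :
    ∑ p, sgn (word F p x) * sgn (word F p y) =
      if x + y = 0 ∧ F x + F y = 0 then 2 * (Fintype.card K : ℝ) ^ 2 else 0 := by
  simp only [← sgn_add, word_add, and_comm (a := x + y = 0)]
  simp only [sgn_add, sum_sgn_trace_mul_sgn_trace]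

theorem sum_sgn_word_four (F : K → K) (x y z t : K) :
    ∑ p, sgn (word F p x) * sgn (word F p y) * (sgn (word F p z) * sgn (word F p t)) =
      if x + y + (z + t) = 0 ∧ F x + F y + (F z + F t) = 0 then
        2 * (Fintype.card K : ℝ) ^ 2 else 0 := by
  simp only [and_comm (a := x + y + (z + t) = 0)]
  rw [← sum_sgn_trace_mul_sgn_trace]
  refine sum_congr rfl fun p _ => ?_
  rw [← sgn_add, ← sgn_add, ← sgn_add, word_add, word_add, ← sgn_add]
  congr 1
  simp only [mul_add, map_add]
  ring

theorem add_self_eq_zero_of_algebra (x : K) : x + x = 0 := by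
  have := charP_of_injective_algebraMap (algebraMap (ZMod 2) K).injective 2
  exact CharTwo.add_self_eq_zero x

theorem add_eq_zero_iff_eq_of_algebra (x y : K) : x + y = 0 ↔ x = y := by
  have := charP_of_injective_algebraMap (algebraMap (ZMod 2) K).injective 2
  exact CharTwo.add_eq_zero

theorem sum_sgn_word_two_of_ne (F : K → K) {x y : K} (h : x ≠ y) :
    ∑ p, sgn (word F p x) * sgn (word F p y) = 0 := by
  rw [sum_sgn_word_two, if_neg]
  rw [add_eq_zero_iff_eq_of_algebra]
  exact fun hh => h hh.1

theorem sum_signSum_mul_sgn_word (F : K → K) (x : K) :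
    ∑ p, signSum F p * sgn (word F p x) = 2 * (Fintype.card K : ℝ) ^ 2 := by
  simp only [signSum, sum_mul]
  rw [sum_comm]
  simp only [sum_sgn_word_two, add_eq_zero_iff_eq_of_algebra]
  rw [sum_eq_single x (fun z _ hz => if_neg fun hh => hz hh.1) (by simp), if_pos ⟨rfl, rfl⟩]

/-- Expanding the square gives fourfold sums over z, t that survive only when z + t = x + y and F z
+ F t = F x + F y. The first equation determines t from z, so the second counts the solutions z. -/
theorem sum_signSum_sq_mul_sgn_word (F : K → K) (x y : K) :
    ∑ p, signSum F p ^ 2 * (sgn (word F p x) * sgn (word F p y)) =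
      2 * (Fintype.card K : ℝ) ^ 2 * diffCount F (x + y) (F x + F y) := by
  simp only [signSum, sq, sum_mul_sum]
  simp only [sum_mul]
  rw [sum_comm, ← sq, diffCount, card_filter, Nat.cast_sum, mul_sum]
  refine sum_congr rfl fun z _ => ?_
  rw [sum_comm]
  simp only [sum_sgn_word_four]
  rw [sum_eq_single (z + (x + y))]
  · have h1 : z + (z + (x + y)) + (x + y) = 0 := by
      linear_combination add_self_eq_zero_of_algebra z + add_self_eq_zero_of_algebra (x + y)
    have h2 : (F z + F (z + (x + y)) + (F x + F y) = 0) ↔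
        F (z + (x + y)) + F z = F x + F y := by
      rw [add_eq_zero_iff_eq_of_algebra, add_comm]
    simp [h1, h2]
  · intro t _ ht
    rw [if_neg]
    rintro ⟨h, -⟩
    apply ht
    rw [← add_eq_zero_iff_eq_of_algebra]
    linear_combination h
  · simp

theorem word_complement (F : K → K) (p : K × K × ZMod 2) (x : K) :
    word F (p.1, p.2.1, p.2.2 + 1) x = word F p x + 1 := by
  simp only [word, add_assoc]

theorem sgn_word_complement (F : K → K) (p : K × K × ZMod 2) (x : K) :
    sgn (word F (p.1, p.2.1, p.2.2 + 1) x) = -sgn (word F p x) := by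
  rw [word_complement, sgn_add, sgn_one, mul_neg_one]

theorem signSum_complement (F : K → K) (p : K × K × ZMod 2) :
    signSum F (p.1, p.2.1, p.2.2 + 1) = -signSum F p := by
  simp only [signSum, sgn_word_complement, sum_neg_distrib]

/-- A function that changes its sign when codewords are complemented has sum zero. -/
theorem sum_eq_zero_of_complement (f : K × K × ZMod 2 → ℝ)
    (hf : ∀ p, f (p.1, p.2.1, p.2.2 + 1) = -f p) : ∑ p, f p = 0 := by
  have key : ∑ p, -f p = ∑ p, f p := by
    refine Fintype.sum_equiv
      ((Equiv.refl K).prodCongr ((Equiv.refl K).prodCongr (Equiv.addRight 1))) _ _ fun p => ?_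
    exact (hf p).symm
  rw [sum_neg_distrib] at key
  linarith

/-! ### Moments independent of the pair of points, and interpolation from them. -/

/-- The sums of `f p x y` over the parameters `p` agree for all pairs of distinct points. -/
def ConstSum {ι : Type*} (A : Finset ι) (f : ι → K → K → ℝ) : Prop :=
  ∃ L : ℝ, ∀ x y, x ≠ y → ∑ p ∈ A, f p x y = L

theorem ConstSum.const_mul {ι : Type*} {A : Finset ι} {f : ι → K → K → ℝ} (hf : ConstSum A f)
    (a : ℝ) : ConstSum A fun p x y => a * f p x y := by
  obtain ⟨L, hL⟩ := hf
  exact ⟨a * L, fun x y h => by rw [← mul_sum, hL x y h]⟩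

theorem ConstSum.sum {ι κ : Type*} {A : Finset ι} (s : Finset κ) {f : κ → ι → K → K → ℝ}
    (hf : ∀ k ∈ s, ConstSum A (f k)) : ConstSum A fun p x y => ∑ k ∈ s, f k p x y := by
  choose! L hL using hf
  refine ⟨∑ k ∈ s, L k, fun x y h => ?_⟩
  rw [sum_comm]
  exact sum_congr rfl fun k hk => hL k hk x y h

theorem constSum_moment (F : K → K) {D : ℕ}
    (hD : ∀ x y, x ≠ y → diffCount F (x + y) (F x + F y) = D) {k i j : ℕ}
    (hk : k < 3) (hi : i < 2) (hj : j < 2) :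
    ConstSum univ fun p x y =>
      signSum F p ^ k * (sgn (word F p x) ^ i * sgn (word F p y) ^ j) := by
  have hodd : ∀ k i j : ℕ, Odd (k + (i + j)) →
      ConstSum univ fun p x y =>
        signSum F p ^ k * (sgn (word F p x) ^ i * sgn (word F p y) ^ j) := by
    intro k i j h
    refine ⟨0, fun x y _ => sum_eq_zero_of_complement _ fun p => ?_⟩
    simp only [signSum_complement, sgn_word_complement]
    rw [neg_pow (signSum F p), neg_pow (sgn _) i, neg_pow (sgn _) j]
    have : (-1 : ℝ) ^ k * ((-1) ^ i * (-1) ^ j) = -1 := by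
      rw [← pow_add, ← pow_add, h.neg_one_pow]
    linear_combination
      (signSum F p ^ k * (sgn (word F p x) ^ i * sgn (word F p y) ^ j)) * this
  by_cases ho : Odd (k + (i + j))
  · exact hodd k i j ho
  interval_cases i <;> interval_cases j
  -- With i = j = 0 the points do not occur in the summand.
  · exact ⟨_, fun x y _ => by simp only [pow_zero]; rfl⟩
  · interval_cases k
    · exact absurd (by decide) ho
    · refine ⟨2 * (Fintype.card K : ℝ) ^ 2, fun x y _ => ?_⟩
      simpa using sum_signSum_mul_sgn_word F y
    · exact absurd (by decide) ho
  · interval_cases k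
    · exact absurd (by decide) ho
    · refine ⟨2 * (Fintype.card K : ℝ) ^ 2, fun x y _ => ?_⟩
      simpa using sum_signSum_mul_sgn_word F x
    · exact absurd (by decide) ho
  · interval_cases k
    · exact ⟨0, fun x y h => by simpa using sum_sgn_word_two_of_ne F h⟩
    · exact absurd (by decide) ho
    · refine ⟨2 * (Fintype.card K : ℝ) ^ 2 * D, fun x y h => ?_⟩
      simpa [hD x y h] using sum_signSum_sq_mul_sgn_word F x y

/-- For the zero function the word does not depend on u, so its full moment is |K| times the moment
over the slice u = 0; its relevant differential counts all equal |K|. -/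
theorem constSum_moment_affine {k i j : ℕ} (hk : k < 3) (hi : i < 2) (hj : j < 2) (F : K → K) :
    ConstSum (univ.filter fun p : K × K × ZMod 2 => p.1 = 0) fun p x y =>
      signSum F p ^ k * (sgn (word F p x) ^ i * sgn (word F p y) ^ j) := by
  obtain ⟨L, hL⟩ := constSum_moment (fun _ : K => (0 : K)) (D := Fintype.card K)
    (fun x y _ => by simp [diffCount]) hk hi hj
  refine ⟨L / Fintype.card K, fun x y h => ?_⟩
  rw [eq_div_iff (by simp), ← hL x y h, Fintype.sum_prod_type]
  have e1 : ∀ (u : K) (q : K × ZMod 2) z, word (fun _ : K => (0 : K)) (u, q) z = word F (0, q) z := by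
    intro u q z
    simp [word]
  have e2 : ∀ (u : K) (q : K × ZMod 2),
      signSum (fun _ : K => (0 : K)) (u, q) = signSum F (0, q) := by
    intro u q
    simp [signSum, e1]
  simp only [e1, e2, sum_const, card_univ, nsmul_eq_mul]
  rw [mul_comm, sum_filter, Fintype.sum_prod_type]
  congr 1
  rw [sum_eq_single 0]
  · simp
  · intro u _ hu
    simp [hu]
  · simp

theorem constSum_moment_compl (F : K → K) {D : ℕ}
    (hD : ∀ x y, x ≠ y → diffCount F (x + y) (F x + F y) = D) {k i j : ℕ}
    (hk : k < 3) (hi : i < 2) (hj : j < 2) :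
    ConstSum (univ.filter fun p : K × K × ZMod 2 => ¬ p.1 = 0) fun p x y =>
      signSum F p ^ k * (sgn (word F p x) ^ i * sgn (word F p y) ^ j) := by
  obtain ⟨L, hL⟩ := constSum_moment F hD hk hi hj
  obtain ⟨M, hM⟩ := constSum_moment_affine hk hi hj F
  refine ⟨L - M, fun x y h => ?_⟩
  rw [← hL x y h, ← hM x y h, ← sum_filter_add_sum_filter_not univ (fun p => p.1 = 0)]
  ring

/-- Every function of two bits and of a number that takes only the values `0, M, -M` is a linear
combination of the moments. -/
theorem exists_moment_coeff {M : ℝ} (hM : M ≠ 0) (φ : ℝ → ZMod 2 → ZMod 2 → ℝ) :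
    ∃ a : ℕ → ℕ → ℕ → ℝ, ∀ s, s = 0 ∨ s = M ∨ s = -M → ∀ b c : ZMod 2,
      φ s b c = ∑ k ∈ range 3, ∑ i ∈ range 2, ∑ j ∈ range 2,
        a k i j * (s ^ k * (sgn b ^ i * sgn c ^ j)) := by
  have h1 : ∀ f : ZMod 2 → ZMod 2 → ℝ, ∃ a : ℕ → ℕ → ℝ, ∀ b c : ZMod 2,
      f b c = ∑ i ∈ range 2, ∑ j ∈ range 2, a i j * (sgn b ^ i * sgn c ^ j) := by
    intro f
    -- Fourier inversion on two bits.
    refine ⟨fun i j => (f 0 0 + (-1) ^ j * f 0 1 + (-1) ^ i * f 1 0 +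
      (-1) ^ (i + j) * f 1 1) / 4, fun b c => ?_⟩
    rcases zmod_two_cases b with rfl | rfl <;> rcases zmod_two_cases c with rfl | rfl <;>
      simp [sum_range_succ, sgn_zero, sgn_one] <;> ring
  obtain ⟨a0, h0⟩ := h1 (φ 0)
  obtain ⟨a1, h1'⟩ := h1 (φ M)
  obtain ⟨a2, h2⟩ := h1 (φ (-M))
  -- Quadratic Lagrange interpolation in s at the nodes 0, M, -M.
  refine ⟨fun k i j => if k = 0 then a0 i j else if k = 1 then (a1 i j - a2 i j) / (2 * M)
    else ((a1 i j + a2 i j) / 2 - a0 i j) / M ^ 2, fun s hs b c => ?_⟩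
  rcases hs with rfl | rfl | rfl
  · rw [h0]
    simp [sum_range_succ]
  · rw [h1']
    simp only [sum_range_succ, range_zero, sum_empty]
    norm_num
    field_simp
    ring
  · rw [h2]
    simp only [sum_range_succ, range_zero, sum_empty]
    norm_num
    field_simp
    ring

theorem constSum_of_moments {F : K → K} {A : Finset (K × K × ZMod 2)}
    (hA : ∀ k i j : ℕ, k < 3 → i < 2 → j < 2 → ConstSum A fun p x y =>
      signSum F p ^ k * (sgn (word F p x) ^ i * sgn (word F p y) ^ j))
    {M : ℝ} (hM : M ≠ 0) (hS : ∀ p ∈ A, signSum F p = 0 ∨ signSum F p = M ∨ signSum F p = -M)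
    (φ : ℝ → ZMod 2 → ZMod 2 → ℝ) :
    ConstSum A fun p x y => φ (signSum F p) (word F p x) (word F p y) := by
  obtain ⟨a, ha⟩ := exists_moment_coeff hM φ
  have : ConstSum A fun p x y => ∑ k ∈ range 3, ∑ i ∈ range 2, ∑ j ∈ range 2,
      a k i j * (signSum F p ^ k * (sgn (word F p x) ^ i * sgn (word F p y) ^ j)) :=
    .sum _ fun k hk => .sum _ fun i hi => .sum _ fun j hj =>
      (hA k i j (mem_range.mp hk) (mem_range.mp hi) (mem_range.mp hj)).const_mul _
  obtain ⟨L, hL⟩ := this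
  refine ⟨L, fun x y h => ?_⟩
  rw [← hL x y h]
  exact sum_congr rfl fun p hp => ha _ (hS p hp) _ _

theorem signSum_eq_walsh (F : K → K) (u v : K) (c : ZMod 2) :
    signSum F (u, v, c) = walsh F u v * sgn c := by
  simp only [signSum, walsh, word, sgn_add _ c, sum_mul, Int.cast_sum, Int.cast_pow, Int.cast_neg,
    Int.cast_one]
  rfl

theorem walsh_zero_left (F : K → K) (v : K) :
    (walsh F 0 v : ℝ) = if v = 0 then (Fintype.card K : ℝ) else 0 := by
  rw [← sum_sgn_trace]
  simp [walsh, sgn, mul_comm]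

theorem signSum_eq_card_sub (F : K → K) (p : K × K × ZMod 2) :
    signSum F p = Fintype.card K - 2 * (support (word F p)).card := by
  have : ∀ z : ZMod 2, sgn z = 1 - 2 * (if z ≠ 0 then 1 else 0) := by
    intro z
    rcases zmod_two_cases z with rfl | rfl
    · simp [sgn_zero]
    · norm_num [sgn_one]
  simp only [signSum, this, sum_sub_distrib, ← mul_sum, sum_boole, support]
  simp

theorem constSum_word (F : K → K) {D : ℕ}
    (hD : ∀ x y, x ≠ y → diffCount F (x + y) (F x + F y) = D) {M : ℝ} (hM : M ≠ 0)
    (hW : ∀ u v, u ≠ 0 → (walsh F u v : ℝ) = 0 ∨ (walsh F u v : ℝ) = M ∨ (walsh F u v : ℝ) = -M)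
    (G : ℕ → ZMod 2 → ZMod 2 → ℝ) :
    ConstSum univ fun p x y => G (support (word F p)).card (word F p x) (word F p y) := by
  -- The weight is recovered from the sign sum; the floor is exact at every actual value.
  let φ : ℝ → ZMod 2 → ZMod 2 → ℝ := fun s => G ⌊((Fintype.card K : ℝ) - s) / 2⌋₊
  have hφ : ∀ p, φ (signSum F p) = G (support (word F p)).card := by
    intro p
    have : ((Fintype.card K : ℝ) - signSum F p) / 2 = (support (word F p)).card := by
      rw [signSum_eq_card_sub]
      ring
    simp only [φ, this, Nat.floor_natCast]
  have hsgn : ∀ (r s : ℝ) (c : ZMod 2), r = 0 ∨ r = s ∨ r = -s →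
      r * sgn c = 0 ∨ r * sgn c = s ∨ r * sgn c = -s := by
    intro r s c h
    rcases zmod_two_cases c with rfl | rfl <;> rcases h with rfl | rfl | rfl <;>
      simp [sgn_zero, sgn_one]
  obtain ⟨L, hL⟩ := constSum_of_moments
    (fun _ _ _ hk hi hj => constSum_moment_affine hk hi hj F)
    (M := Fintype.card K) (by simp) (fun ⟨u, v, c⟩ hp => by
      obtain rfl : u = 0 := (mem_filter.mp hp).2
      rw [signSum_eq_walsh]
      refine hsgn _ _ _ ?_
      rw [walsh_zero_left]
      split_ifs <;> simp) φ
  obtain ⟨L', hL'⟩ := constSum_of_moments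
    (fun _ _ _ hk hi hj => constSum_moment_compl F hD hk hi hj) hM (fun ⟨u, v, c⟩ hp => by
      rw [signSum_eq_walsh]
      exact hsgn _ _ _ (hW u v (mem_filter.mp hp).2)) φ
  refine ⟨L + L', fun x y h => ?_⟩
  rw [← hL x y h, ← hL' x y h, sum_filter_add_sum_filter_not]
  simp only [hφ]

/-! ### From parameters to codewords, and the conclusion. -/

/-- The parametrization of `code F`. -/
noncomputable def wordHom (F : K → K) : (K × K × ZMod 2) →+ (K → ZMod 2) where
  toFun := word F
  map_zero' := by ext; simp [word]
  map_add' p q := by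
    ext x
    simp only [word, Pi.add_apply, Prod.fst_add, Prod.snd_add, add_mul, map_add]
    ring

theorem mem_code_iff (F : K → K) (w : K → ZMod 2) : w ∈ code F ↔ ∃ p, word F p = w := by
  constructor
  · rintro ⟨a, b, c, rfl⟩
    exact ⟨(a, b, c), rfl⟩
  · rintro ⟨⟨a, b, c⟩, rfl⟩
    exact ⟨a, b, c, rfl⟩

/-- The parametrization need not be injective, but it is additive, so every fibre is a translate of
the kernel and each codeword is counted equally often. -/
theorem sum_word_eq (F : K → K) (h : (K → ZMod 2) → ℝ) :
    ∑ p, h (word F p) =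
      (univ.filter fun p => word F p = 0).card * ∑ c : K → ZMod 2 with c ∈ code F, h c := by
  rw [← sum_fiberwise_of_maps_to (s := univ) (t := univ.filter fun c => c ∈ code F) (g := word F)
    (fun p _ => by simp [mem_code_iff]), mul_sum]
  refine sum_congr rfl fun c hc => ?_
  obtain ⟨q, rfl⟩ := (mem_code_iff F c).mp (mem_filter.mp hc).2
  rw [sum_congr rfl fun p hp => by rw [(mem_filter.mp hp).2], sum_const, nsmul_eq_mul]
  congr 2
  refine (card_equiv (Equiv.addRight q) fun p => ?_).symm
  have := (wordHom F).map_add p q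
  change word F (p + q) = word F p + word F q at this
  simp [this]

theorem pairHomogeneous_code (F : K → K) {D : ℕ}
    (hD : ∀ x y, x ≠ y → diffCount F (x + y) (F x + F y) = D) {M : ℝ} (hM : M ≠ 0)
    (hW : ∀ u v, u ≠ 0 → (walsh F u v : ℝ) = 0 ∨ (walsh F u v : ℝ) = M ∨ (walsh F u v : ℝ) = -M) :
    PairHomogeneous (code F) := by
  intro G
  obtain ⟨L, hL⟩ := constSum_word F hD hM hW G
  have h0 : ((univ.filter fun p => word F p = 0).card : ℝ) ≠ 0 := by
    rw [Nat.cast_ne_zero]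
    have hz : word F 0 = 0 := (wordHom F).map_zero
    exact card_ne_zero_of_mem (a := 0) (by simp [hz])
  refine ⟨L / (univ.filter fun p => word F p = 0).card, fun x y h => ?_⟩
  rw [eq_div_iff h0, ← hL x y h, sum_word_eq F fun c => G (support c).card (c x) (c y), mul_comm]

/-- The point x solves the defining equation, which rules out the value 0. -/
theorem IsDiffTwoValued.diffCount_eq {F : K → K} {s : ℕ} (hF : IsDiffTwoValued F s) {x y : K}
    (h : x ≠ y) : diffCount F (x + y) (F x + F y) = 2 ^ s := by
  have hmem : diffCount F (x + y) (F x + F y) ∈ ({0, 2 ^ s} : Set ℕ) := by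
    rw [← hF]
    exact ⟨_, _, by rwa [Ne, add_eq_zero_iff_eq_of_algebra], rfl⟩
  refine hmem.resolve_left (card_pos.mpr ⟨x, ?_⟩).ne'
  have : x + (x + y) = y := by linear_combination add_self_eq_zero_of_algebra x
  rw [mem_filter, this]
  exact ⟨mem_univ _, add_comm _ _⟩

end Functions

end VectorialDesign

theorem mainTheorem6 {K : Type*} [Field K] [Fintype K] [Algebra (ZMod 2) K] (n s : ℕ)
    (hK : Fintype.card K = 2 ^ n) (F : K → K)
    (hF : VectorialDesign.IsDiffTwoValued F s)
    (hW : {r : ℝ | ∃ u v : K, u ≠ 0 ∧ (VectorialDesign.walsh F u v : ℝ) = r} =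
      {0, (2 : ℝ) ^ (((n : ℝ) + (s : ℝ)) / 2), -(2 : ℝ) ^ (((n : ℝ) + (s : ℝ)) / 2)}) :
    VectorialDesign.SupportsDesigns (VectorialDesign.code F) 2 ∧
      VectorialDesign.SupportsDesigns
        (VectorialDesign.dualCode (VectorialDesign.code F)) 2 := by
  have h := VectorialDesign.pairHomogeneous_code F (fun x y h => hF.diffCount_eq h)
    (Real.rpow_pos_of_pos two_pos (((n : ℝ) + (s : ℝ)) / 2)).ne' fun u v hu => by
      have : (VectorialDesign.walsh F u v : ℝ) ∈ {r : ℝ | ∃ u v : K, u ≠ 0 ∧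
        (VectorialDesign.walsh F u v : ℝ) = r} := ⟨u, v, hu, rfl⟩
      rw [hW] at this
      exact this
  have hP : 2 ≤ Fintype.card K := Fintype.one_lt_card
  exact ⟨h.supportsDesigns hP, h.supportsDesigns_dualCode hP⟩
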